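/- Let $Q$ be a metric network: a finite multigraph (loops and parallel arcs allowed) in which every arc $e$ is identified with an open interval of length $\lambda(e)>0$ attached to its end nodes. Give $Q$ the shortest-path metric and the measure $\lambda$ (length) that is Lebesgue measure on each arc, and suppose that $\lambda(Q)=1$. Suppose that $Q$ is 2-connected, that is, $Q$ is connected and $Q\setminus\{v\}$ is connected for every node $v$. Then: (a) $Q$ can be partitioned into two connected subsets $A,B$ with $\lambda(A)=\lambda(B)=1/2$. (b) Consider the zero-sum game $\Gamma'_1(Q)$ in which the defender chooses a point $x\in Q$ (the place of the booby trap), the attacker, not knowing $x$, chooses a connected subset $S\subseteq Q$, and the attacker, who wants to maximize the expected reward that the defender wants to minimize, receives $\lambda(S)$ if $x\notin S$ and $0$ if $x\in S$. In mixed strategies this game has the value $1/4$. It is optimal for the defender to place the trap at random according to $\lambda$ (the uniform strategy). For every partition $A,B$ as in (a), it is optimal for the attacker to choose each of $A$ and $B$ with probability $1/2$. -/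

import Mathlib

open MeasureTheory Set
open scoped ENNReal

/-- A metric network: a multigraph with node type `V` and arc type `E` (loops and parallel arcs are
allowed), in which every arc `e` carries a positive length `len e`.  The choice of which endpoint of
an arc is called `src` and which `tgt` is only used to parametrize the arc. -/
structure MetricNetwork (V E : Type*) where
  src : E → V
  tgt : E → V
  len : E → ℝ
  len_pos : ∀ e, 0 < len e

namespace MetricNetwork

variable {V E : Type*} (N : MetricNetwork V E)

/-- The points of the network `Q`: the nodes, and for every arc `e` an open interval of length
`len e`. -/
inductive Point : Type _ where
  | node (v : V) : Point
  | inner (e : E) (t : ℝ) (h0 : 0 < t) (h1 : t < N.len e) : Point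

open Classical in
/-- The parametrization by arc length of the closed arc `e`: `0` is sent to `src e`, `len e` to
`tgt e`.  (Parameters outside `[0, len e]` are sent to the nearer endpoint.) -/
noncomputable def arc (e : E) (t : ℝ) : N.Point :=
  if h0 : 0 < t then
    if h1 : t < N.len e then Point.inner e t h0 h1 else Point.node (N.tgt e)
  else Point.node (N.src e)

/-- `x` and `y` lie on a common closed arc, and `c` is the length of the piece of that arc between
them. -/
def IsSegment (x y : N.Point) (c : ℝ≥0∞) : Prop :=
  ∃ e : E, ∃ s ∈ Icc 0 (N.len e), ∃ t ∈ Icc 0 (N.len e),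
    N.arc e s = x ∧ N.arc e t = y ∧ c = ENNReal.ofReal |s - t|

/-- `c` is the length of a path from `x` to `y` made of finitely many consecutive segments. -/
inductive IsPathLength : N.Point → N.Point → ℝ≥0∞ → Prop where
  | nil (x : N.Point) : IsPathLength x x 0
  | cons {x y z : N.Point} {a b : ℝ≥0∞} :
      N.IsSegment x y a → IsPathLength y z b → IsPathLength x z (a + b)

variable {N}

theorem IsSegment.symm {x y : N.Point} {c : ℝ≥0∞} (h : N.IsSegment x y c) :
    N.IsSegment y x c := by
  obtain ⟨e, s, hs, t, ht, rfl, rfl, rfl⟩ := h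
  exact ⟨e, t, ht, s, hs, rfl, rfl, by rw [abs_sub_comm]⟩

theorem IsPathLength.append {x y z : N.Point} {a b : ℝ≥0∞} (h : N.IsPathLength x y a)
    (h' : N.IsPathLength y z b) : N.IsPathLength x z (a + b) := by
  induction h with
  | nil x => simpa using h'
  | cons hs _ ih => rw [add_assoc]; exact .cons hs (ih h')

theorem IsPathLength.symm {x y : N.Point} {c : ℝ≥0∞} (h : N.IsPathLength x y c) :
    N.IsPathLength y x c := by
  induction h with
  | nil x => exact .nil x
  | cons hs _ ih =>
    have h1 := ih.append (.cons hs.symm (.nil _))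
    rwa [add_zero, add_comm] at h1

/-- The shortest-path distance on the network. -/
noncomputable instance : PseudoEMetricSpace N.Point where
  edist x y := sInf {c | N.IsPathLength x y c}
  edist_self x := le_antisymm (sInf_le (IsPathLength.nil x)) (zero_le)
  edist_comm x y := by
    congr 1
    ext c
    exact ⟨IsPathLength.symm, IsPathLength.symm⟩
  edist_triangle x y z := by
    change sInf _ ≤ sInf _ + sInf _
    rw [ENNReal.sInf_add]
    refine le_iInf₂ fun a ha => ?_
    rw [add_comm, ENNReal.sInf_add]
    refine le_iInf₂ fun b hb => ?_
    rw [add_comm]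
    exact sInf_le (IsPathLength.append ha hb)

theorem edist_def (x y : N.Point) : edist x y = sInf {c | N.IsPathLength x y c} := rfl

/-- A function that is 1-Lipschitz along every arc is 1-Lipschitz on the network. -/
theorem ofReal_abs_sub_le_edist {f : N.Point → ℝ}
    (hf : ∀ e, ∀ s ∈ Icc 0 (N.len e), ∀ t ∈ Icc 0 (N.len e),
      |f (N.arc e s) - f (N.arc e t)| ≤ |s - t|) (x y : N.Point) :
    ENNReal.ofReal |f x - f y| ≤ edist x y := by
  refine le_sInf fun c hc => ?_
  induction hc with
  | nil x => simp
  | @cons x y z a b hs _ ih =>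
    obtain ⟨e, s, hs, t, ht, rfl, rfl, rfl⟩ := hs
    calc ENNReal.ofReal |f (N.arc e s) - f z|
        ≤ ENNReal.ofReal (|f (N.arc e s) - f (N.arc e t)| + |f (N.arc e t) - f z|) :=
          ENNReal.ofReal_le_ofReal (abs_sub_le _ _ _)
      _ = _ := ENNReal.ofReal_add (abs_nonneg _) (abs_nonneg _)
      _ ≤ _ := add_le_add (ENNReal.ofReal_le_ofReal (hf e s hs t ht)) ih

theorem arc_zero (e : E) : N.arc e 0 = Point.node (N.src e) := by simp [arc]

theorem arc_len (e : E) : N.arc e (N.len e) = Point.node (N.tgt e) := by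
  simp [arc, N.len_pos e]

theorem arc_inner (e : E) (t : ℝ) (h0 : 0 < t) (h1 : t < N.len e) :
    N.arc e t = Point.inner e t h0 h1 := by simp [arc, h0, h1]

theorem arc_cases (e : E) {t : ℝ} (ht : t ∈ Icc 0 (N.len e)) :
    t = 0 ∨ t = N.len e ∨ (0 < t ∧ t < N.len e) := by
  rcases ht.1.eq_or_lt with h | h
  · exact Or.inl h.symm
  · rcases ht.2.eq_or_lt with h' | h'
    · exact Or.inr (Or.inl h')
    · exact Or.inr (Or.inr ⟨h, h'⟩)

theorem arc_clamp (e : E) (t : ℝ) : N.arc e (max 0 (min t (N.len e))) = N.arc e t := by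
  have := N.len_pos e
  rcases le_or_gt t 0 with h | h
  · rw [max_eq_left ((min_le_left _ _).trans h)]
    simp [arc, h.not_gt]
  · rcases lt_or_ge t (N.len e) with h' | h'
    · rw [min_eq_left h'.le, max_eq_right h.le]
    · rw [min_eq_right h', max_eq_right this.le]
      simp [arc, h, h'.not_gt, this]

theorem lipschitzWith_arc (e : E) : LipschitzWith 1 (N.arc e) := by
  intro s t
  have hL := N.len_pos e
  have hm : ∀ u : ℝ, max 0 (min u (N.len e)) ∈ Icc 0 (N.len e) := fun u =>
    ⟨le_max_left _ _, max_le hL.le (min_le_right _ _)⟩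
  have h1 : |max 0 (min s (N.len e)) - max 0 (min t (N.len e))| ≤ |s - t| := by
    grind
  rw [← arc_clamp e s, ← arc_clamp e t, ENNReal.coe_one, one_mul, edist_dist s t, Real.dist_eq]
  have h2 := (IsPathLength.cons ⟨e, _, hm s, _, hm t, rfl, rfl, rfl⟩ (IsPathLength.nil _) :
    N.IsPathLength (N.arc e (max 0 (min s (N.len e)))) (N.arc e (max 0 (min t (N.len e)))) _)
  rw [add_zero] at h2
  exact (sInf_le h2).trans (ENNReal.ofReal_le_ofReal h1)

theorem eq_inner_of_edist_eq_zero {e : E} {s : ℝ} {h0 : 0 < s} {h1 : s < N.len e} {y : N.Point}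
    (h : edist (Point.inner e s h0 h1) y = 0) : y = Point.inner e s h0 h1 := by
  classical
  let r := min s (N.len e - s)
  have hr : 0 < r := lt_min h0 (sub_pos.2 h1)
  let f : N.Point → ℝ := fun p => match p with
    | .node _ => 0
    | .inner e' t _ _ => if e' = e then max 0 (r - |t - s|) else 0
  have harc : ∀ t ∈ Icc 0 (N.len e), f (N.arc e t) = max 0 (r - |t - s|) := by
    intro t ht
    have hr1 : r ≤ s := min_le_left _ _
    have hr2 : r ≤ N.len e - s := min_le_right _ _
    rcases arc_cases e ht with rfl | rfl | ⟨h, h'⟩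
    · rw [arc_zero]; simp only [f]; grind
    · rw [arc_len]; simp only [f]; grind
    · rw [arc_inner _ _ h h']; simp [f]
  have harc' : ∀ e' ≠ e, ∀ t, f (N.arc e' t) = 0 := by
    intro e' he t
    unfold arc
    split_ifs <;> simp [f, he]
  have key := ofReal_abs_sub_le_edist (f := f) (fun e' a ha b hb => by
    by_cases he : e' = e
    · subst he
      rw [harc a ha, harc b hb]
      grind
    · rw [harc' e' he, harc' e' he]; simp) (Point.inner e s h0 h1) y
  rw [h, nonpos_iff_eq_zero, ENNReal.ofReal_eq_zero] at key
  have hfy : f y = r := by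
    have h3 : f (Point.inner e s h0 h1) = r := by simp [f, hr.le]
    have h4 := abs_nonpos_iff.1 key
    linarith
  cases y with
  | node v => simp only [f] at hfy; linarith
  | inner e' t _ _ =>
    simp only [f] at hfy
    split_ifs at hfy with he
    · subst he
      have : t = s := by grind
      subst this
      rfl
    · linarith

/-- On a network with finitely many arcs the shortest-path distance separates points. -/
noncomputable instance [Finite E] : EMetricSpace N.Point where
  eq_of_edist_eq_zero := by
    classical
    intro x y h
    cases x with
    | inner e s h0 h1 => exact (eq_inner_of_edist_eq_zero h).symm
    | node v =>
      cases y with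
      | inner e s h0 h1 => rw [edist_comm] at h; exact eq_inner_of_edist_eq_zero h
      | node w =>
        by_contra hne
        have hvw : w ≠ v := fun h => hne (by rw [h])
        obtain ⟨m, hm, hml⟩ : ∃ m : ℝ, 0 < m ∧ ∀ e, m ≤ N.len e := by
          rcases isEmpty_or_nonempty E with hE | hE
          · exact ⟨1, one_pos, fun e => hE.elim e⟩
          · obtain ⟨e, he⟩ := Finite.exists_min N.len
            exact ⟨N.len e, N.len_pos e, he⟩
        let g : V → ℝ := fun u => if u = v then m else 0
        have hg : ∀ a b, |g a - g b| ≤ m := by intro a b; simp only [g]; grind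
        let f : N.Point → ℝ := fun p => match p with
          | .node u => g u
          | .inner e t _ _ => g (N.src e) + t / N.len e * (g (N.tgt e) - g (N.src e))
        have harc : ∀ e, ∀ t ∈ Icc 0 (N.len e), f (N.arc e t) =
            g (N.src e) + t / N.len e * (g (N.tgt e) - g (N.src e)) := by
          intro e t ht
          rcases arc_cases e ht with rfl | rfl | ⟨h, h'⟩
          · rw [arc_zero]; simp [f]
          · rw [arc_len, div_self (N.len_pos e).ne']; simp [f]
          · rw [arc_inner _ _ h h']
        have key := ofReal_abs_sub_le_edist (f := f) (fun e s hs t ht => by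
          have hL := N.len_pos e
          rw [harc e s hs, harc e t ht]
          have : g (N.src e) + s / N.len e * (g (N.tgt e) - g (N.src e)) -
              (g (N.src e) + t / N.len e * (g (N.tgt e) - g (N.src e))) =
              (s - t) * ((g (N.tgt e) - g (N.src e)) / N.len e) := by ring
          rw [this, abs_mul, abs_div, abs_of_pos hL]
          exact mul_le_of_le_one_right (abs_nonneg _)
            ((div_le_one hL).2 ((hg _ _).trans (hml e)))) (.node v) (.node w)
        rw [h, nonpos_iff_eq_zero, ENNReal.ofReal_eq_zero] at key
        have h4 := abs_nonpos_iff.1 key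
        simp only [f, g, if_true, if_neg hvw] at h4
        linarith

noncomputable instance : MeasurableSpace N.Point := borel _

instance : BorelSpace N.Point := ⟨rfl⟩

theorem measurable_arc (e : E) : Measurable (N.arc e) :=
  (lipschitzWith_arc e).continuous.measurable

variable (N)

/-- `N` is 2-connected: it is connected, and it remains connected upon removal of any node. -/
def IsTwoConnected : Prop :=
  IsConnected (univ : Set N.Point) ∧ ∀ v : V, IsConnected ({Point.node v}ᶜ : Set N.Point)

/-- Length, as a Borel measure on the network: Lebesgue measure on every arc. -/
noncomputable def length [Fintype E] : Measure N.Point :=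
  ∑ e, (volume.restrict (Ioo 0 (N.len e))).map (N.arc e)

theorem length_univ [Fintype E] : N.length univ = ENNReal.ofReal (∑ e, N.len e) := by
  rw [ENNReal.ofReal_sum_of_nonneg fun e _ => (N.len_pos e).le]
  simp [length, Measure.map_apply (measurable_arc _) MeasurableSet.univ]

/-- The pure strategies of the attacker: the connected subsets of the network. -/
structure ConnectedSubset where
  carrier : Set N.Point
  isConnected : IsConnected carrier

/-- The sigma-algebra on the attacker's pure strategies: the smallest one for which `S ↦ μ S` is
measurable for every finite Borel measure `μ` on the network. -/
noncomputable instance : MeasurableSpace N.ConnectedSubset :=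
  ⨆ μ : FiniteMeasure N.Point,
    MeasurableSpace.comap (fun S => (μ : Measure N.Point) S.carrier) (borel ℝ≥0∞)

variable {N}

open Classical in
/-- The reward of the attacker who takes `S` when the single booby trap is at `x`. -/
noncomputable def payoff [Fintype E] (x : N.Point) (S : N.ConnectedSubset) : ℝ≥0∞ :=
  if x ∈ S.carrier then 0 else N.length S.carrier

/-- The expected reward, when the defender draws the trap from `μ` and the attacker, independently,
draws the connected set from `σ`. -/
noncomputable def expectedPayoff [Fintype E] (μ : ProbabilityMeasure N.Point)
    (σ : ProbabilityMeasure N.ConnectedSubset) : ℝ≥0∞ :=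
  ∫⁻ S, ∫⁻ x, payoff x S ∂(μ : Measure N.Point) ∂(σ : Measure N.ConnectedSubset)

/-- The worst-case expected reward that the defender strategy `μ` concedes. -/
noncomputable def defenderGuarantee [Fintype E] (μ : ProbabilityMeasure N.Point) : ℝ≥0∞ :=
  ⨆ σ : ProbabilityMeasure N.ConnectedSubset, expectedPayoff μ σ

/-- The worst-case expected reward that the attacker strategy `σ` secures. -/
noncomputable def attackerGuarantee [Fintype E] (σ : ProbabilityMeasure N.ConnectedSubset) :
    ℝ≥0∞ :=
  ⨅ μ : ProbabilityMeasure N.Point, expectedPayoff μ σ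

variable (N) in
/-- The zero-sum game with one booby trap on the network `N` (minimizing defender, maximizing
attacker) has the value `v` in mixed strategies. -/
def HasGameValue [Fintype E] (v : ℝ≥0∞) : Prop :=
  (⨅ μ : ProbabilityMeasure N.Point, defenderGuarantee μ) = v ∧
    (⨆ σ : ProbabilityMeasure N.ConnectedSubset, attackerGuarantee σ) = v

/-- The defender strategy `μ` is optimal: no defender strategy concedes less. -/
def IsOptimalDefender [Fintype E] (μ : ProbabilityMeasure N.Point) : Prop :=
  ∀ μ' : ProbabilityMeasure N.Point, defenderGuarantee μ ≤ defenderGuarantee μ'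

/-- The attacker strategy `σ` is optimal: no attacker strategy secures more. -/
def IsOptimalAttacker [Fintype E] (σ : ProbabilityMeasure N.ConnectedSubset) : Prop :=
  ∀ σ' : ProbabilityMeasure N.ConnectedSubset, attackerGuarantee σ' ≤ attackerGuarantee σ

variable (N) in
/-- The uniform defender strategy on a network of total length 1: the trap is distributed according
to length. -/
noncomputable def uniformStrategy [Fintype E] (h : ∑ e, N.len e = 1) :
    ProbabilityMeasure N.Point :=
  ⟨N.length, ⟨by rw [length_univ, h, ENNReal.ofReal_one]⟩⟩

/-- The attacker strategy that takes each of `A` and `B` with probability `1/2`. -/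
noncomputable def evenMixture (A B : N.ConnectedSubset) : ProbabilityMeasure N.ConnectedSubset :=
  ⟨(2⁻¹ : ℝ≥0∞) • Measure.dirac A + (2⁻¹ : ℝ≥0∞) • Measure.dirac B,
    ⟨by simp [ENNReal.inv_two_add_inv_two]⟩⟩

/-- `A` and `B` form a partition of the network into two connected subsets of length `1/2` each. -/
def IsEqualPartition [Fintype E] (A B : N.ConnectedSubset) : Prop :=
  Disjoint A.carrier B.carrier ∧ A.carrier ∪ B.carrier = univ ∧
    N.length A.carrier = 1 / 2 ∧ N.length B.carrier = 1 / 2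

end MetricNetwork

/-! Halving the network. If there is a loop, 2-connectedness forces the network to be that single
loop (`eq_of_loop`), a circle that is cut into two halves. Otherwise let s and t be the ends of some
arc. A connected graph without cut vertices has a bipolar numbering: distinct numbers such that
every vertex but s has a smaller neighbour and every vertex but t a larger one
(`exists_bipolar_numbering`). Interpolate it affinely along the arcs. From any point one can descend
to s, so sublevel sets are connected; from any point one can ascend to t, so strict superlevel sets
are connected too (`isPreconnected_of_lower`, applied to the numbering and to its negative). As the
two ends of an arc have different numbers, each level meets each arc in at most one inner point. So
the length of the sublevel set varies continuously with the level, and some level splits the length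
evenly.

The game. Against the uniform trap a connected set S earns λ(S)(1 - λ(S)) ≤ 1/4. Against the even
mixture of A and B any trap misses exactly one part, so the attacker earns 1/2 · 1/2 = 1/4. These
two bounds form a saddle point. Evaluating the expectations needs connected sets to be Borel
(`measurableSet_of_isPreconnected`). -/

/-! ### Bipolar numberings of graphs without cut vertices -/

section BipolarNumbering

variable {V : Type*} {adj : V → V → Prop}

/-- The vertices that can be reached from `t` by a walk all of whose later vertices lie in `B`. -/
def reachable (adj : V → V → Prop) (B : Set V) (t : V) : Set V :=
  {x | Relation.ReflTransGen (fun a b => adj a b ∧ b ∈ B) t x}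

theorem mem_reachable_self (B : Set V) (t : V) : t ∈ reachable adj B t :=
  Relation.ReflTransGen.refl

theorem mem_reachable_of_adj {B : Set V} {t a b : V} (ha : a ∈ reachable adj B t)
    (h : adj a b) (hb : b ∈ B) : b ∈ reachable adj B t :=
  Relation.ReflTransGen.tail ha ⟨h, hb⟩

theorem reachable_subset {B : Set V} {t : V} (ht : t ∈ B) : reachable adj B t ⊆ B := by
  intro x hx
  rcases Relation.ReflTransGen.cases_tail hx with h | ⟨_, _, h⟩
  · exact h ▸ ht
  · exact h.2

/-- In a graph without cut vertices, a set `B` all of whose vertices can be reached from `t ∈ B`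
has a vertex other than `t` that has a neighbour outside `B` and whose removal keeps all of `B`
reachable from `t`. -/
theorem exists_removable [Finite V] (symm : ∀ a b, adj a b → adj b a)
    (hcut : ∀ v (C : Set V), v ∉ C → C.Nonempty → (∃ x, x ∉ C ∧ x ≠ v) →
      ∃ x ∈ C, ∃ y, y ∉ C ∧ y ≠ v ∧ adj x y)
    {B : Set V} {t : V} (ht : t ∈ B) (hB : B ⊆ reachable adj B t) (hBt : ∃ b ∈ B, b ≠ t)
    (hBc : Bᶜ.Nonempty) :
    ∃ v ∈ B, v ≠ t ∧ (∃ a, a ∉ B ∧ adj v a) ∧ B \ {v} ⊆ reachable adj (B \ {v}) t := by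
  classical
  let F : Set V := {v | v ∈ B ∧ v ≠ t ∧ ∃ a, a ∉ B ∧ adj v a}
  have hF : F.Nonempty := by
    obtain ⟨b, hb, hbt⟩ := hBt
    obtain ⟨x, hx, y, hy, hyt, hxy⟩ := hcut t Bᶜ (by simpa using ht) hBc
      ⟨b, by simpa using hb, hbt⟩
    exact ⟨y, by simpa using hy, hyt, x, hx, symm _ _ hxy⟩
  -- Among the boundary vertices of `B` other than `t`, take one whose removal leaves the most
  -- vertices reachable. If some vertices are still cut off, then, `v` being no cut vertex, one of
  -- them, `x`, has a neighbour outside `B`; removing `x` instead will turn out to leave strictly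
  -- more reachable.
  obtain ⟨v, ⟨hvB, hvt, hva⟩, hmax⟩ := (Set.toFinite F).exists_maximalFor
    (fun v => (reachable adj (B \ {v}) t).ncard) F hF
  refine ⟨v, hvB, hvt, hva, ?_⟩
  by_contra hnot
  obtain ⟨c, hc, hcR⟩ := Set.not_subset.1 hnot
  have htv : t ∈ B \ {v} := ⟨ht, fun h => hvt h.symm⟩
  obtain ⟨x, ⟨hxB, hxR⟩, y, hy, hyv, hxy⟩ := hcut v ((B \ {v}) \ reachable adj (B \ {v}) t)
    (by simp) ⟨c, hc, hcR⟩ ⟨t, fun h => h.2 (mem_reachable_self _ _), fun h => hvt h.symm⟩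
  have hyB : y ∉ B := by
    intro hyB
    have hyR : y ∈ reachable adj (B \ {v}) t := by
      by_contra hyR
      exact hy ⟨⟨hyB, hyv⟩, hyR⟩
    exact hxR (mem_reachable_of_adj hyR (symm _ _ hxy) hxB)
  have hxt : x ≠ t := fun h => hxR (h ▸ mem_reachable_self _ _)
  have hsub : reachable adj (B \ {v}) t ⊆ reachable adj (B \ {x}) t := by
    intro z hz
    induction hz with
    | refl => exact mem_reachable_self _ _
    | @tail a b hab h ih =>
      have hb : b ∈ reachable adj (B \ {v}) t := mem_reachable_of_adj hab h.1 h.2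
      exact mem_reachable_of_adj ih h.1 ⟨h.2.1, fun hbx => hxR (hbx ▸ hb)⟩
  have hvx : v ∈ B \ {x} := ⟨hvB, fun h => hxB.2 h.symm⟩
  -- Up to its first visit to `v`, a walk from `t` in `B` stays in the part reachable without `v`,
  -- hence avoids `x`. So `v` itself is reachable once `x` is removed, and this makes the gain
  -- strict.
  have hv : ∀ z ∈ reachable adj B t,
      z ∈ reachable adj (B \ {v}) t ∨ v ∈ reachable adj (B \ {x}) t := by
    intro z hz
    induction hz with
    | refl => exact Or.inl (mem_reachable_self _ _)
    | @tail a b hab h ih =>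
      rcases ih with ih | ih
      · by_cases hbv : b = v
        · exact Or.inr (mem_reachable_of_adj (hsub ih) (hbv ▸ h.1) hvx)
        · exact Or.inl (mem_reachable_of_adj ih h.1 ⟨h.2, hbv⟩)
      · exact Or.inr ih
  have hvn : v ∉ reachable adj (B \ {v}) t := fun h => (reachable_subset htv h).2 rfl
  have hvR := (hv v (hB hvB)).resolve_left hvn
  have hlt : (reachable adj (B \ {v}) t).ncard < (reachable adj (B \ {x}) t).ncard :=
    Set.ncard_lt_ncard ⟨hsub, fun h => hvn (h hvR)⟩ (Set.toFinite _)
  exact absurd (hmax (j := x) ⟨hxB.1, hxt, y, hyB, hxy⟩ hlt.le) (not_le.2 hlt)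

/-- Peel vertices off `B` with `exists_removable`, numbering them upwards in the order of removal
and ending with `t`. Vertices outside `B` count as already numbered lower, which is why an outside
neighbour may replace a smaller one. -/
theorem exists_numbering_of_reachable [Finite V] (symm : ∀ a b, adj a b → adj b a)
    (hcut : ∀ v (C : Set V), v ∉ C → C.Nonempty → (∃ x, x ∉ C ∧ x ≠ v) →
      ∃ x ∈ C, ∃ y, y ∉ C ∧ y ≠ v ∧ adj x y)
    (hconn : ∀ C : Set V, C.Nonempty → Cᶜ.Nonempty → ∃ x ∈ C, ∃ y ∉ C, adj x y) {t : V}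
    (n : ℕ) (B : Set V) (hn : B.ncard = n) (ht : t ∈ B) (hB : B ⊆ reachable adj B t)
    (hBc : Bᶜ.Nonempty) :
    ∃ f : V → ℕ, InjOn f B ∧
      (∀ v ∈ B, (∃ a, a ∉ B ∧ adj v a) ∨ ∃ w ∈ B, adj v w ∧ f w < f v) ∧
      ∀ v ∈ B, v ≠ t → ∃ w ∈ B, adj v w ∧ f v < f w := by
  classical
  induction n generalizing B with
  | zero => exact absurd ht (by rw [(Set.ncard_eq_zero (Set.toFinite B)).1 hn]; simp)
  | succ n ih =>
    by_cases hBt : ∃ b ∈ B, b ≠ t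
    · obtain ⟨v, hvB, hvt, ⟨a, haB, hva⟩, hR⟩ := exists_removable symm hcut ht hB hBt hBc
      have htv : t ∈ B \ {v} := ⟨ht, fun h => hvt h.symm⟩
      obtain ⟨f, hf, hlow, hup⟩ := ih (B \ {v})
        (by have := Set.ncard_sdiff_singleton_add_one hvB (Set.toFinite B); omega) htv hR
        ⟨v, by simp⟩
      -- The last step of a walk in `B` that first reaches `v` comes from such a `w`; it will be the
      -- larger neighbour of `v`.
      obtain ⟨w, hw, hvw⟩ : ∃ w ∈ B \ {v}, adj v w := by
        by_contra! hno
        have key : ∀ z ∈ reachable adj B t, z ≠ v := by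
          intro z hz
          induction hz with
          | refl => exact fun h => hvt h.symm
          | @tail p q hp h ih =>
            rintro rfl
            exact hno p ⟨reachable_subset ht hp, ih⟩ (symm _ _ h.1)
        exact key v (hB hvB) rfl
      -- The removed vertex gets the least number. A neighbour outside `B \ {v}` is then either
      -- still outside `B`, or is `v`, which is now smaller.
      refine ⟨fun x => if x = v then 0 else f x + 1, ?_, ?_, ?_⟩
      · intro x hx y hy hxy
        by_cases hxv : x = v <;> by_cases hyv : y = v <;> simp [hxv, hyv] at hxy ⊢
        exact hf ⟨hx, hxv⟩ ⟨hy, hyv⟩ hxy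
      · intro x hx
        by_cases hxv : x = v
        · exact Or.inl ⟨a, haB, hxv ▸ hva⟩
        · rcases hlow x ⟨hx, hxv⟩ with ⟨b, hb, hxb⟩ | ⟨w, hw, hxw, hlt⟩
          · by_cases hbv : b = v
            · exact Or.inr ⟨v, hvB, hbv ▸ hxb, by simp [hxv]⟩
            · exact Or.inl ⟨b, fun h => hb ⟨h, hbv⟩, hxb⟩
          · exact Or.inr ⟨w, hw.1, hxw, by simpa [hxv, show w ≠ v from hw.2] using hlt⟩
      · intro x hx hxt
        by_cases hxv : x = v
        · exact ⟨w, hw.1, hxv ▸ hvw, by simp [hxv, show w ≠ v from hw.2]⟩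
        · obtain ⟨w, hw, hxw, hlt⟩ := hup x ⟨hx, hxv⟩ hxt
          exact ⟨w, hw.1, hxw, by simpa [hxv, show w ≠ v from hw.2] using hlt⟩
    · push Not at hBt
      obtain ⟨x, hx, y, hy, hxy⟩ := hconn B ⟨t, ht⟩ hBc
      refine ⟨fun _ => 0, fun x hx y hy _ => (hBt x hx).trans (hBt y hy).symm, ?_, ?_⟩
      · intro v hv
        exact Or.inl ⟨y, hy, by rw [hBt v hv, ← hBt x hx]; exact hxy⟩
      · intro v hv hvt
        exact absurd (hBt v hv) hvt

/-- A connected graph without cut vertices has, for any two vertices `s ≠ t`, a numbering in which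
every vertex but `s` has a smaller neighbour and every vertex but `t` a larger one. -/
theorem exists_bipolar_numbering [Finite V] (symm : ∀ a b, adj a b → adj b a)
    (hcut : ∀ v (C : Set V), v ∉ C → C.Nonempty → (∃ x, x ∉ C ∧ x ≠ v) →
      ∃ x ∈ C, ∃ y, y ∉ C ∧ y ≠ v ∧ adj x y)
    (hconn : ∀ C : Set V, C.Nonempty → Cᶜ.Nonempty → ∃ x ∈ C, ∃ y ∉ C, adj x y) {s t : V}
    (hst : s ≠ t) :
    ∃ f : V → ℕ, Function.Injective f ∧ (∀ v, v ≠ s → ∃ w, adj v w ∧ f w < f v) ∧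
      ∀ v, v ≠ t → ∃ w, adj v w ∧ f v < f w := by
  classical
  -- As `s` is no cut vertex, the remaining vertices can all be reached from `t` without it; so the
  -- peeling can start from the complement of `s`.
  have hB : ({s}ᶜ : Set V) ⊆ reachable adj {s}ᶜ t := by
    intro x hx
    by_contra hxR
    obtain ⟨a, ha, b, hb, hbs, hab⟩ := hcut s (reachable adj {s}ᶜ t)
      (fun h => reachable_subset (B := {s}ᶜ) (fun h => hst h.symm) h rfl)
      ⟨t, mem_reachable_self _ _⟩ ⟨x, hxR, hx⟩
    exact hb (mem_reachable_of_adj ha hab hbs)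
  obtain ⟨f, hf, hlow, hup⟩ := exists_numbering_of_reachable symm hcut hconn _ {s}ᶜ rfl
    (fun h => hst h.symm) hB ⟨s, by simp⟩
  obtain ⟨x, hx, y, hy, hxy⟩ := hconn {s} ⟨s, rfl⟩ ⟨t, fun h => hst h.symm⟩
  have hys : y ≠ s := hy
  refine ⟨fun x => if x = s then 0 else f x + 1, ?_, ?_, ?_⟩
  · intro x y hxy
    by_cases hxv : x = s <;> by_cases hyv : y = s <;> simp [hxv, hyv] at hxy ⊢
    exact hf hxv hyv hxy
  · intro v hv
    rcases hlow v hv with ⟨a, ha, hva⟩ | ⟨w, hw, hvw, hlt⟩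
    · have has : a = s := by simpa using ha
      exact ⟨a, hva, by simp [has, hv]⟩
    · exact ⟨w, hvw, by simpa [hv, show w ≠ s from hw] using hlt⟩
  · intro v hvt
    by_cases hv : v = s
    · exact ⟨y, by rw [hv, ← show x = s from hx]; exact hxy, by simp [hv, hys]⟩
    · obtain ⟨w, hw, hvw, hlt⟩ := hup v hv hvt
      exact ⟨w, hvw, by simpa [hv, show w ≠ s from hw] using hlt⟩

end BipolarNumbering

/-! ### From topological to combinatorial 2-connectedness -/

namespace MetricNetwork

variable {V E : Type*} {N : MetricNetwork V E}

theorem node_mem_range_arc {e : E} {v : V} (h : Point.node v ∈ range (N.arc e)) :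
    v = N.src e ∨ v = N.tgt e := by
  obtain ⟨t, ht⟩ := h
  unfold arc at ht
  split_ifs at ht
  · exact Or.inr (Point.node.inj ht).symm
  · exact Or.inl (Point.node.inj ht).symm

theorem inner_mem_range_arc {e e' : E} {t : ℝ} {h0 : 0 < t} {h1 : t < N.len e}
    (h : Point.inner e t h0 h1 ∈ range (N.arc e')) : e = e' := by
  obtain ⟨s, hs⟩ := h
  unfold arc at hs
  split_ifs at hs
  injection hs with h _
  exact h.symm

theorem inner_mem_range_arc_self (e : E) (t : ℝ) (h0 : 0 < t) (h1 : t < N.len e) :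
    Point.inner e t h0 h1 ∈ range (N.arc e) := ⟨t, arc_inner e t h0 h1⟩

theorem continuous_arc (e : E) : Continuous (N.arc e) := (lipschitzWith_arc e).continuous

theorem range_arc (e : E) : range (N.arc e) = N.arc e '' Icc 0 (N.len e) := by
  refine Subset.antisymm ?_ (image_subset_range _ _)
  rintro _ ⟨t, rfl⟩
  exact ⟨_, ⟨le_max_left _ _, max_le (N.len_pos e).le (min_le_right _ _)⟩, arc_clamp e t⟩

theorem isClosed_range_arc [Finite E] (e : E) : IsClosed (range (N.arc e)) := by
  rw [range_arc]
  exact (isCompact_Icc.image (continuous_arc e)).isClosed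

theorem isClosed_nodes_union_arcs [Finite V] [Finite E] (C : Set V) (F : Set E) :
    IsClosed (Point.node '' C ∪ ⋃ e ∈ F, range (N.arc e)) :=
  ((Set.toFinite _).isClosed).union
    ((Set.toFinite F).isClosed_biUnion fun e _ => isClosed_range_arc e)

/-- If the network stays connected upon removal of the nodes in `D`, then every nontrivial partition
of the remaining nodes is crossed by an arc. -/
theorem exists_crossing_arc [Finite V] [Finite E] {D C : Set V}
    (h : IsPreconnected ((Point.node '' D)ᶜ : Set N.Point)) (hCD : Disjoint C D)
    (hC : C.Nonempty) (hC' : ∃ y, y ∉ C ∧ y ∉ D) :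
    ∃ x ∈ C, ∃ y, y ∉ C ∧ y ∉ D ∧
      ∃ e, (N.src e = x ∧ N.tgt e = y) ∨ (N.src e = y ∧ N.tgt e = x) := by
  by_contra! hno
  -- The nodes of `C` with the closed arcs touching `C`, and the other nodes with the other arcs,
  -- are two closed sets covering the network. Without a crossing arc they can meet only in `D`,
  -- which contradicts connectedness off `D`.
  let F : Set E := {e | N.src e ∈ C ∨ N.tgt e ∈ C}
  obtain ⟨c, hc⟩ := hC
  obtain ⟨y, hy, hyD⟩ := hC'
  obtain ⟨p, hpD, hp, hp'⟩ := isPreconnected_closed_iff.1 h _ _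
    (isClosed_nodes_union_arcs C F) (isClosed_nodes_union_arcs Cᶜ Fᶜ) (by
      rintro (v | ⟨e, t, h0, h1⟩) -
      · by_cases hv : v ∈ C
        · exact Or.inl (Or.inl ⟨v, hv, rfl⟩)
        · exact Or.inr (Or.inl ⟨v, hv, rfl⟩)
      · by_cases he : e ∈ F
        · exact Or.inl (Or.inr (mem_biUnion he (inner_mem_range_arc_self _ _ _ _)))
        · exact Or.inr (Or.inr (mem_biUnion (s := Fᶜ) he (inner_mem_range_arc_self _ _ _ _))))
    ⟨.node c, by simpa using fun h => disjoint_left.1 hCD hc h, Or.inl ⟨c, hc, rfl⟩⟩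
    ⟨.node y, by simpa using hyD, Or.inl ⟨y, hy, rfl⟩⟩
  simp only [mem_union, mem_iUnion] at hp hp'
  cases p with
  | node v =>
    have hvD : v ∉ D := by simpa using hpD
    have h1 : v ∈ C := by
      rcases hp with ⟨w, hw, hwv⟩ | ⟨e, he, hev⟩
      · exact Point.node.inj hwv ▸ hw
      · by_contra hvC
        rcases node_mem_range_arc hev with rfl | rfl
        · rcases he with he | he
          · exact hvC he
          · exact (hno _ he _ hvC hvD e).2 rfl rfl
        · rcases he with he | he
          · exact (hno _ he _ hvC hvD e).1 rfl rfl
          · exact hvC he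
    rcases hp' with ⟨w, hw, hwv⟩ | ⟨e, he, hev⟩
    · exact hw (Point.node.inj hwv ▸ h1)
    · rcases node_mem_range_arc hev with rfl | rfl
      · exact he (Or.inl h1)
      · exact he (Or.inr h1)
  | inner e t h0 h1 =>
    rcases hp with ⟨w, hw, hwv⟩ | ⟨e₁, he, hev⟩
    · cases hwv
    rcases hp' with ⟨w, hw, hwv⟩ | ⟨e₂, he', hev'⟩
    · cases hwv
    exact he' (inner_mem_range_arc hev' ▸ inner_mem_range_arc hev ▸ he)

/-- If removing the base node of a loop leaves the network connected, then the network consists of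
this loop only. -/
theorem eq_of_loop [Finite V] [Finite E] {e : E} (he : N.src e = N.tgt e)
    (h : IsPreconnected ({Point.node (N.src e)}ᶜ : Set N.Point)) :
    (∀ v, v = N.src e) ∧ ∀ e', e' = e := by
  have hL := fun e => half_pos (N.len_pos e)
  have hL' := fun e => half_lt_self (N.len_pos e)
  -- The closed loop and the rest of the network are closed sets that share at most the base node;
  -- once this is removed, the rest must be empty.
  have key : ¬ (({Point.node (N.src e)}ᶜ : Set N.Point) ∩
      (Point.node '' {N.src e}ᶜ ∪ ⋃ e' ∈ ({e}ᶜ : Set E), range (N.arc e'))).Nonempty := by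
    intro hne
    obtain ⟨p, hpD, hp, hp'⟩ := isPreconnected_closed_iff.1 h _ _
      (isClosed_range_arc e) (isClosed_nodes_union_arcs {N.src e}ᶜ {e}ᶜ) (by
        rintro (v | ⟨e', t, h0, h1⟩) hv
        · exact Or.inr (Or.inl ⟨v, by simpa using hv, rfl⟩)
        · by_cases he : e' = e
          · subst he
            exact Or.inl (inner_mem_range_arc_self _ _ _ _)
          · exact Or.inr (Or.inr (mem_biUnion (s := {e}ᶜ) he (inner_mem_range_arc_self _ _ _ _))))
      ⟨.inner e _ (hL e) (hL' e), by simp, inner_mem_range_arc_self _ _ _ _⟩ hne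
    cases p with
    | node v =>
      have hv : v ≠ N.src e := by simpa using hpD
      rcases node_mem_range_arc hp with h | h
      · exact hv h
      · exact hv (h.trans he.symm)
    | inner e' t h0 h1 =>
      have h2 := inner_mem_range_arc hp
      subst h2
      simp only [mem_union, mem_iUnion] at hp'
      rcases hp' with ⟨w, hw, hwv⟩ | ⟨e₂, he', hev'⟩
      · cases hwv
      · exact he' (inner_mem_range_arc hev').symm
  constructor
  · intro v
    by_contra hv
    exact key ⟨.node v, by simpa using hv, Or.inl ⟨v, hv, rfl⟩⟩
  · intro e'
    by_contra he'
    exact key ⟨.inner e' _ (hL e') (hL' e'), by simp,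
      Or.inr (mem_biUnion (s := {e}ᶜ) he' (inner_mem_range_arc_self _ _ _ _))⟩

/-! ### Open arcs as open subsets, and Borel measurability of connected sets -/

/-- Points near an inner point of an arc lie on the same arc. -/
theorem exists_eq_inner_of_edist_lt {e : E} {s r : ℝ} {h0 : 0 < s} {h1 : s < N.len e}
    (hr1 : r ≤ s) (hr2 : r ≤ N.len e - s) {y : N.Point}
    (h : edist (Point.inner e s h0 h1) y < ENNReal.ofReal r) :
    ∃ t, ∃ (h0' : 0 < t) (h1' : t < N.len e), y = Point.inner e t h0' h1' ∧ |t - s| < r := by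
  classical
  have hr : 0 < r := ENNReal.ofReal_pos.1 ((zero_le).trans_lt h)
  -- A tent of height `r` and slope 1 centred at `s`. It is 1-Lipschitz for the network distance, so
  -- it is positive at every point closer than `r`.
  let f : N.Point → ℝ := fun p => match p with
    | .node _ => 0
    | .inner e' t _ _ => if e' = e then max 0 (r - |t - s|) else 0
  have harc : ∀ t ∈ Icc 0 (N.len e), f (N.arc e t) = max 0 (r - |t - s|) := by
    intro t ht
    rcases arc_cases e ht with rfl | rfl | ⟨h, h'⟩
    · rw [arc_zero]; simp only [f]; grind
    · rw [arc_len]; simp only [f]; grind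
    · rw [arc_inner _ _ h h']; simp [f]
  have harc' : ∀ e' ≠ e, ∀ t, f (N.arc e' t) = 0 := by
    intro e' he t
    unfold arc
    split_ifs <;> simp [f, he]
  have key := (ofReal_abs_sub_le_edist (f := f) (fun e' a ha b hb => by
    by_cases he : e' = e
    · subst he
      rw [harc a ha, harc b hb]
      grind
    · rw [harc' e' he, harc' e' he]; simp) (Point.inner e s h0 h1) y).trans_lt h
  rw [ENNReal.ofReal_lt_ofReal_iff hr] at key
  have h3 : f (Point.inner e s h0 h1) = r := by simp [f, hr.le]
  rw [h3] at key
  cases y with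
  | node v => simp only [f, sub_zero] at key; exact absurd (le_abs_self r) (not_le.2 key)
  | inner e' t h0' h1' =>
    simp only [f] at key
    split_ifs at key with he
    · subst he
      exact ⟨t, h0', h1', rfl, by grind⟩
    · rw [sub_zero] at key; exact absurd (le_abs_self r) (not_le.2 key)

theorem isOpen_arc_image (e : E) {U : Set ℝ} (hU : IsOpen U) (hsub : U ⊆ Ioo 0 (N.len e)) :
    IsOpen (N.arc e '' U) := by
  rw [EMetric.isOpen_iff]
  rintro _ ⟨s, hs, rfl⟩
  obtain ⟨h0, h1⟩ := hsub hs
  obtain ⟨ε, hε, hb⟩ := Metric.isOpen_iff.1 hU s hs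
  refine ⟨ENNReal.ofReal (min ε (min s (N.len e - s))),
    ENNReal.ofReal_pos.2 (lt_min hε (lt_min h0 (sub_pos.2 h1))), fun y hy => ?_⟩
  rw [arc_inner _ _ h0 h1, Metric.mem_eball, edist_comm] at hy
  obtain ⟨t, ht0, ht1, rfl, ht⟩ := exists_eq_inner_of_edist_lt
    ((min_le_right _ _).trans (min_le_left _ _)) ((min_le_right _ _).trans (min_le_right _ _)) hy
  exact ⟨t, hb (by rw [Metric.mem_ball, Real.dist_eq]; exact ht.trans_le (min_le_left _ _)),
    arc_inner _ _ _ _⟩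

theorem injOn_arc (e : E) : InjOn (N.arc e) (Ioo 0 (N.len e)) := by
  intro s hs t ht h
  rw [arc_inner _ _ hs.1 hs.2, arc_inner _ _ ht.1 ht.2] at h
  injection h

/-- The parametrization embeds the open interval as an open subset of the network, so it carries
Borel sets to Borel sets. -/
theorem measurableSet_arc_image (e : E) {P : Set ℝ} (hP : MeasurableSet P)
    (hsub : P ⊆ Ioo 0 (N.len e)) : MeasurableSet (N.arc e '' P) := by
  have hemb : Topology.IsOpenEmbedding (fun t : Ioo 0 (N.len e) => N.arc e t) := by
    refine .of_continuous_injective_isOpenMap ((continuous_arc e).comp continuous_subtype_val)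
      (injOn_iff_injective.1 (injOn_arc e)) fun U hU => ?_
    have := isOpen_arc_image e (isOpen_Ioo.isOpenMap_subtype_val U hU)
      (by rintro _ ⟨x, -, rfl⟩; exact x.2)
    rwa [image_image] at this
  have := hemb.measurableEmbedding.measurableSet_image' (hP.preimage measurable_subtype_coe)
  convert this using 1
  ext x
  constructor
  · rintro ⟨t, ht, rfl⟩
    exact ⟨⟨t, hsub ht⟩, ht, rfl⟩
  · rintro ⟨t, ht, rfl⟩
    exact ⟨t, ht, rfl⟩

/-- A connected set that contains neither end of a piece of an arc is contained in this piece or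
disjoint from it. -/
theorem subset_or_disjoint_of_notMem [Finite E] {S : Set N.Point} (hS : IsPreconnected S) (e : E)
    {b d : ℝ} (hb : 0 < b) (hd : d < N.len e) (hbS : N.arc e b ∉ S) (hdS : N.arc e d ∉ S) :
    S ⊆ N.arc e '' Ioo b d ∨ Disjoint S (N.arc e '' Ioo b d) := by
  have hcl : IsClosed (N.arc e '' Icc b d) := (isCompact_Icc.image (continuous_arc e)).isClosed
  have hsub : S ⊆ N.arc e '' Ioo b d ∪ (N.arc e '' Icc b d)ᶜ := by
    intro x hx
    by_cases h : x ∈ N.arc e '' Icc b d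
    · obtain ⟨t, ⟨h1, h2⟩, rfl⟩ := h
      refine Or.inl ⟨t, ⟨h1.lt_of_ne ?_, h2.lt_of_ne ?_⟩, rfl⟩
      · rintro rfl; exact hbS hx
      · rintro rfl; exact hdS hx
    · exact Or.inr h
  have hdisj : Disjoint (N.arc e '' Ioo b d) (N.arc e '' Icc b d)ᶜ :=
    disjoint_compl_right_iff_subset.2 (image_mono Ioo_subset_Icc_self)
  rcases hS.subset_or_subset
    (isOpen_arc_image e isOpen_Ioo (Ioo_subset_Ioo hb.le hd.le)) hcl.isOpen_compl hdisj hsub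
    with h | h
  · exact Or.inl h
  · exact Or.inr (hdisj.symm.mono_left h)

/-- Connected subsets of a network are Borel sets. -/
theorem measurableSet_of_isPreconnected [Finite V] [Finite E] {S : Set N.Point}
    (hS : IsPreconnected S) : MeasurableSet S := by
  let P : E → Set ℝ := fun e => Ioo 0 (N.len e) ∩ N.arc e ⁻¹' S
  have hP : ∀ e, MeasurableSet (P e) := by
    intro e
    have hcases : ∀ b ∈ Ioo 0 (N.len e) \ P e, ∀ d ∈ Ioo 0 (N.len e) \ P e,
        P e ⊆ Ioo b d ∨ Disjoint (P e) (Ioo b d) := by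
      rintro b ⟨hb, hbP⟩ d ⟨hd, hdP⟩
      rcases subset_or_disjoint_of_notMem hS e hb.1 hd.2 (fun h => hbP ⟨hb, h⟩)
        (fun h => hdP ⟨hd, h⟩) with h | h
      · left
        rintro t ⟨ht, htS⟩
        obtain ⟨t', ht', heq⟩ := h htS
        rwa [← injOn_arc e ⟨hb.1.trans ht'.1, ht'.2.trans hd.2⟩ ht heq]
      · right
        rw [disjoint_left]
        rintro t ⟨ht, htS⟩ ht'
        exact disjoint_left.1 h htS ⟨t, ht', rfl⟩
    -- The trace on an arc need not be an interval, since the set may enter from both ends and leave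
    -- a gap. If the missing part is an interval, the trace is a difference of intervals. Otherwise
    -- some trace point lies between two missing points; the whole set is then confined between
    -- these, and a further gap would disconnect it.
    by_cases hO : (Ioo 0 (N.len e) \ P e).OrdConnected
    · have : P e = Ioo 0 (N.len e) \ (Ioo 0 (N.len e) \ P e) := by
        rw [sdiff_sdiff_cancel_left inter_subset_left]
      rw [this]
      exact measurableSet_Ioo.diff hO.measurableSet
    · have hO' : ∃ b ∈ Ioo 0 (N.len e) \ P e, ∃ d ∈ Ioo 0 (N.len e) \ P e,
          ¬ Disjoint (P e) (Ioo b d) := by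
        by_contra! hno
        refine hO ⟨fun b hb d hd t ht => ?_⟩
        refine ⟨⟨hb.1.1.trans_le ht.1, ht.2.trans_lt hd.1.2⟩, fun htP => ?_⟩
        refine disjoint_left.1 (hno b hb d hd) htP ⟨ht.1.lt_of_ne ?_, ht.2.lt_of_ne ?_⟩
        · rintro rfl; exact hb.2 htP
        · rintro rfl; exact hd.2 htP
      obtain ⟨b, hb, d, hd, hbd⟩ := hO'
      have hsub := (hcases b hb d hd).resolve_right hbd
      refine OrdConnected.measurableSet ⟨fun x hx z hz y hy => ?_⟩
      by_contra hyP
      have hyO : y ∈ Ioo 0 (N.len e) \ P e :=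
        ⟨⟨hx.1.1.trans_le hy.1, hy.2.trans_lt hz.1.2⟩, hyP⟩
      have hxy : x < y := hy.1.lt_of_ne (by rintro rfl; exact hyP hx)
      rcases hcases b hb y hyO with h | h
      · exact absurd (h hz).2 (not_lt.2 hy.2)
      · exact disjoint_left.1 h hx ⟨(hsub hx).1, hxy⟩
  have hdecomp : S = Point.node '' {v | Point.node v ∈ S} ∪ ⋃ e, N.arc e '' P e := by
    ext p
    simp only [mem_union, mem_iUnion]
    constructor
    · intro hp
      cases p with
      | node v => exact Or.inl ⟨v, hp, rfl⟩
      | inner e t h0 h1 =>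
        have h := arc_inner (N := N) e t h0 h1
        exact Or.inr ⟨e, t, ⟨⟨h0, h1⟩, by rw [mem_preimage, h]; exact hp⟩, h⟩
    · rintro (⟨v, hv, rfl⟩ | ⟨e, t, ht, rfl⟩)
      · exact hv
      · exact ht.2
  rw [hdecomp]
  exact ((Set.toFinite _).measurableSet).union
    (MeasurableSet.iUnion fun e => measurableSet_arc_image e (hP e) inter_subset_left)

end MetricNetwork

/-! ### Connected level sets of the interpolated numbering -/

namespace MetricNetwork

variable {V E : Type*} {N : MetricNetwork V E}

/-- The function on the network that interpolates a function of the nodes affinely on each arc. -/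
noncomputable def interpolate (N : MetricNetwork V E) (g : V → ℝ) : N.Point → ℝ
  | .node v => g v
  | .inner e t _ _ => g (N.src e) + t / N.len e * (g (N.tgt e) - g (N.src e))

theorem interpolate_arc (g : V → ℝ) (e : E) {t : ℝ} (ht : t ∈ Icc 0 (N.len e)) :
    N.interpolate g (N.arc e t) = g (N.src e) + t / N.len e * (g (N.tgt e) - g (N.src e)) := by
  rcases arc_cases e ht with rfl | rfl | ⟨h, h'⟩
  · rw [arc_zero]; simp [interpolate]
  · rw [arc_len, div_self (N.len_pos e).ne']; simp [interpolate]
  · rw [arc_inner _ _ h h']; rfl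

theorem interpolate_neg (g : V → ℝ) (p : N.Point) :
    N.interpolate (fun v => -g v) p = -N.interpolate g p := by
  cases p <;> simp only [interpolate]
  ring

theorem isPreconnected_arc_image (e : E) (a b : ℝ) : IsPreconnected (N.arc e '' Icc a b) :=
  isPreconnected_Icc.image _ (continuous_arc e).continuousOn

/-- If every node but `s` has a neighbour with a smaller value, then the lower sets of the
interpolated function are connected. -/
theorem isPreconnected_of_lower [Finite V] {g : V → ℝ} {s : V}
    (hg : ∀ v, v ≠ s → ∃ w, (∃ e, (N.src e = v ∧ N.tgt e = w) ∨ (N.src e = w ∧ N.tgt e = v)) ∧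
      g w < g v) {D : Set N.Point}
    (hD : ∀ x ∈ D, ∀ y, N.interpolate g y ≤ N.interpolate g x → y ∈ D) :
    IsPreconnected D := by
  -- Descend along smaller neighbours until `s`, by induction on the value (there are finitely many
  -- nodes). The arcs used stay in `D` because interpolation does not exceed the larger end value.
  have hnode : ∀ v, Point.node v ∈ D → ∃ T ⊆ D, Point.node s ∈ T ∧ Point.node v ∈ T ∧
      IsPreconnected T := by
    intro v
    induction v using (Finite.wellFounded_of_trans_of_irrefl
      (InvImage (· < ·) g : V → V → Prop)).induction with
    | _ v ih =>
    intro hv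
    by_cases hvs : v = s
    · subst hvs
      exact ⟨{.node v}, by simpa using hv, rfl, rfl, isPreconnected_singleton⟩
    · obtain ⟨w, ⟨e, he⟩, hlt⟩ := hg v hvs
      obtain ⟨T, hTD, hsT, hwT, hT⟩ := ih w hlt (hD _ hv _ hlt.le)
      have hL := N.len_pos e
      have h0 : (0 : ℝ) ∈ Icc 0 (N.len e) := ⟨le_rfl, hL.le⟩
      have h1 : N.len e ∈ Icc 0 (N.len e) := ⟨hL.le, le_rfl⟩
      have hvw : Point.node v ∈ N.arc e '' Icc 0 (N.len e) ∧
          Point.node w ∈ N.arc e '' Icc 0 (N.len e) := by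
        rcases he with ⟨rfl, rfl⟩ | ⟨rfl, rfl⟩
        · exact ⟨⟨0, h0, arc_zero e⟩, ⟨_, h1, arc_len e⟩⟩
        · exact ⟨⟨_, h1, arc_len e⟩, ⟨0, h0, arc_zero e⟩⟩
      refine ⟨T ∪ N.arc e '' Icc 0 (N.len e), union_subset hTD ?_, Or.inl hsT, Or.inr hvw.1,
        hT.union _ hwT hvw.2 (isPreconnected_arc_image e _ _)⟩
      rintro _ ⟨t, ht, rfl⟩
      refine hD _ hv _ ?_
      rw [interpolate_arc g e ht]
      change _ ≤ g v
      have ha : 0 ≤ t / N.len e := div_nonneg ht.1 hL.le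
      have hb : t / N.len e ≤ 1 := (div_le_one hL).2 ht.2
      rcases he with ⟨rfl, rfl⟩ | ⟨rfl, rfl⟩ <;> nlinarith
  refine isPreconnected_of_forall (Point.node s) fun p hp => ?_
  cases p with
  | node v => exact hnode v hp
  | inner e t h0 h1 =>
    have hL := N.len_pos e
    have h := arc_inner (N := N) e t h0 h1
    have ht : t ∈ Icc 0 (N.len e) := ⟨h0.le, h1.le⟩
    -- From an inner point, follow the arc towards the end with the smaller value.
    rcases le_total (g (N.src e)) (g (N.tgt e)) with hle | hle
    · have hsub : N.arc e '' Icc 0 t ⊆ D := by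
        rintro _ ⟨u, hu, rfl⟩
        refine hD _ hp _ ?_
        rw [← h, interpolate_arc g e ht, interpolate_arc g e ⟨hu.1, hu.2.trans h1.le⟩]
        have := div_le_div_of_nonneg_right hu.2 hL.le
        nlinarith
      have hm : Point.node (N.src e) ∈ N.arc e '' Icc 0 t := ⟨0, ⟨le_rfl, h0.le⟩, arc_zero e⟩
      obtain ⟨T, hTD, hsT, hwT, hT⟩ := hnode _ (hsub hm)
      exact ⟨T ∪ N.arc e '' Icc 0 t, union_subset hTD hsub, Or.inl hsT,
        Or.inr ⟨t, ⟨h0.le, le_rfl⟩, h⟩,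
        hT.union _ hwT hm (isPreconnected_arc_image e _ _)⟩
    · have hsub : N.arc e '' Icc t (N.len e) ⊆ D := by
        rintro _ ⟨u, hu, rfl⟩
        refine hD _ hp _ ?_
        rw [← h, interpolate_arc g e ht, interpolate_arc g e ⟨h0.le.trans hu.1, hu.2⟩]
        have := div_le_div_of_nonneg_right hu.1 hL.le
        nlinarith
      have hm : Point.node (N.tgt e) ∈ N.arc e '' Icc t (N.len e) :=
        ⟨N.len e, ⟨h1.le, le_rfl⟩, arc_len e⟩
      obtain ⟨T, hTD, hsT, hwT, hT⟩ := hnode _ (hsub hm)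
      exact ⟨T ∪ N.arc e '' Icc t (N.len e), union_subset hTD hsub, Or.inl hsT,
        Or.inr ⟨t, ⟨le_rfl, h1.le⟩, h⟩,
        hT.union _ hwT hm (isPreconnected_arc_image e _ _)⟩

/-! ### Cutting the network into equal halves -/

theorem length_apply [Fintype E] {S : Set N.Point} (hS : MeasurableSet S) :
    N.length S = ∑ e, volume (N.arc e ⁻¹' S ∩ Ioo 0 (N.len e)) := by
  simp only [length, Measure.coe_finsetSum, Finset.sum_apply]
  refine Finset.sum_congr rfl fun e _ => ?_
  rw [Measure.map_apply (measurable_arc e) hS,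
    Measure.restrict_apply (measurable_arc e hS)]

/-- Without atoms the distribution function has no jumps; it tends to 0 and 1 at the two ends, so
the intermediate value theorem applies. -/
theorem _root_.MeasureTheory.exists_measure_Iic_eq_half (ν : Measure ℝ) [IsProbabilityMeasure ν]
    [NullSingletonClass ν] : ∃ c, ν (Iic c) = 1 / 2 := by
  have hcont : Continuous (ProbabilityTheory.cdf ν) := by
    refine continuous_iff_continuousAt.2 fun x => ?_
    rw [(ProbabilityTheory.monotone_cdf ν).continuousAt_iff_leftLim_eq_rightLim,
      StieltjesFunction.rightLim_eq]
    have h := StieltjesFunction.measure_singleton (ProbabilityTheory.cdf ν) x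
    rw [ProbabilityTheory.measure_cdf, measure_singleton, eq_comm, ENNReal.ofReal_eq_zero] at h
    exact le_antisymm ((ProbabilityTheory.monotone_cdf ν).leftLim_le le_rfl) (by linarith)
  obtain ⟨c, hc⟩ := mem_range_of_exists_le_of_exists_ge hcont
    (c := (1 / 2 : ℝ))
    ((((ProbabilityTheory.tendsto_cdf_atBot ν).eventually_lt_const
      (show (0 : ℝ) < 1 / 2 by norm_num)).exists).imp fun _ h => h.le)
    ((((ProbabilityTheory.tendsto_cdf_atTop ν).eventually_const_lt
      (show (1 / 2 : ℝ) < 1 by norm_num)).exists).imp fun _ h => h.le)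
  refine ⟨c, ?_⟩
  rw [ProbabilityTheory.cdf_eq_real] at hc
  rw [← ENNReal.ofReal_toReal (measure_ne_top ν (Iic c))]
  change ENNReal.ofReal (ν.real (Iic c)) = _
  rw [hc, one_div, one_div, ENNReal.ofReal_inv_of_pos two_pos, ENNReal.ofReal_ofNat]

/-- The network is a circle of length 1, cut at the parameters 0 and 1/2. Half-open pieces put the
base node, which is parameter 0 as well as 1, into the first half only. -/
theorem exists_isEqualPartition_of_loop [Finite V] [Fintype E] (hlen : ∑ e, N.len e = 1) {e : E}
    (he : N.src e = N.tgt e)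
    (h : IsPreconnected ({Point.node (N.src e)}ᶜ : Set N.Point)) :
    ∃ A B : N.ConnectedSubset, IsEqualPartition A B := by
  obtain ⟨hV, hE⟩ := eq_of_loop he h
  have hsum : ∀ F : E → ℝ≥0∞, ∑ e, F e = F e := fun F =>
    Fintype.sum_eq_single e fun e' he' => absurd (hE e') he'
  have hL : N.len e = 1 := by
    rw [← hlen]
    exact (Fintype.sum_eq_single e fun e' he' => absurd (hE e') he').symm
  have hA : IsConnected (N.arc e '' Ico 0 (1 / 2)) :=
    (isConnected_Ico (by norm_num)).image _ (continuous_arc e).continuousOn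
  have hB : IsConnected (N.arc e '' Ico (1 / 2) 1) :=
    (isConnected_Ico (by norm_num)).image _ (continuous_arc e).continuousOn
  have hinj : InjOn (N.arc e) (Ico 0 1) := by
    rw [← hL]
    rintro a ⟨ha, ha'⟩ b ⟨hb, hb'⟩ hab
    rcases ha.eq_or_lt with rfl | ha <;> rcases hb.eq_or_lt with rfl | hb
    · rfl
    · rw [arc_zero, arc_inner _ _ hb hb'] at hab; cases hab
    · rw [arc_zero, arc_inner _ _ ha ha'] at hab; cases hab
    · exact injOn_arc e ⟨ha, ha'⟩ ⟨hb, hb'⟩ hab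
  have hpre : ∀ T ⊆ Ico (0 : ℝ) 1, N.arc e ⁻¹' (N.arc e '' T) ∩ Ioo 0 (N.len e) =
      T ∩ Ioo 0 1 := by
    intro T hT
    rw [hL]
    ext t
    constructor
    · rintro ⟨⟨u, hu, hut⟩, ht⟩
      exact ⟨hinj (hT hu) (Ioo_subset_Ico_self ht) hut ▸ hu, ht⟩
    · rintro ⟨ht, ht'⟩
      exact ⟨⟨t, ht, rfl⟩, ht'⟩
  have hTA : Ico (0 : ℝ) (1 / 2) ⊆ Ico 0 1 := Ico_subset_Ico le_rfl (by norm_num)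
  have hTB : Ico (1 / 2 : ℝ) 1 ⊆ Ico 0 1 := Ico_subset_Ico (by norm_num) le_rfl
  have hhalf : ENNReal.ofReal (1 / 2) = 1 / 2 := by
    rw [one_div, one_div, ENNReal.ofReal_inv_of_pos two_pos, ENNReal.ofReal_ofNat]
  refine ⟨⟨_, hA⟩, ⟨_, hB⟩, ?_, ?_, ?_, ?_⟩
  · rw [disjoint_left]
    rintro _ ⟨a, ha, rfl⟩ ⟨b, hb, hab⟩
    exact absurd (hinj (hTB hb) (hTA ha) hab) (ha.2.trans_le hb.1).ne'
  · change N.arc e '' _ ∪ N.arc e '' _ = univ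
    rw [← image_union, Ico_union_Ico_eq_Ico (by norm_num) (by norm_num), eq_univ_iff_forall]
    rintro (v | ⟨e', t, h0, h1⟩)
    · exact ⟨0, by simp, by rw [arc_zero, ← hV v]⟩
    · obtain rfl := hE e'
      exact ⟨t, ⟨h0.le, hL ▸ h1⟩, arc_inner _ _ _ _⟩
  · rw [length_apply (measurableSet_of_isPreconnected hA.isPreconnected), hsum, hpre _ hTA]
    rw [show Ico (0 : ℝ) (1 / 2) ∩ Ioo 0 1 = Ioo 0 (1 / 2) by
      ext t; simp only [mem_inter_iff, mem_Ico, mem_Ioo]; grind]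
    rw [Real.volume_Ioo, sub_zero, hhalf]
  · rw [length_apply (measurableSet_of_isPreconnected hB.isPreconnected), hsum, hpre _ hTB]
    have hsub : Ico (1 / 2 : ℝ) 1 ⊆ Ioo 0 1 := fun t ht =>
      ⟨lt_of_lt_of_le (by norm_num) ht.1, ht.2⟩
    rw [inter_eq_left.2 hsub, Real.volume_Ico,
      show (1 : ℝ) - 1 / 2 = 1 / 2 by norm_num, hhalf]

/-- A 2-connected network of total length 1 can be partitioned into two connected sets of
length `1/2`. -/
theorem exists_isEqualPartition [Finite V] [Fintype E] (hN : N.IsTwoConnected)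
    (hlen : ∑ e, N.len e = 1) : ∃ A B : N.ConnectedSubset, IsEqualPartition A B := by
  by_cases hloop : ∃ e, N.src e = N.tgt e
  · obtain ⟨e, he⟩ := hloop
    exact exists_isEqualPartition_of_loop hlen he (hN.2 _).isPreconnected
  push Not at hloop
  obtain ⟨e₀⟩ : Nonempty E := by
    by_contra hE
    rw [not_nonempty_iff] at hE
    simp at hlen
  -- Removing one node yields the absence of cut vertices, removing none yields connectedness. The
  -- poles are the ends of `e₀`, distinct because there are no loops.
  obtain ⟨f, hf, hlow, hup⟩ := exists_bipolar_numbering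
    (adj := fun v w => ∃ e, (N.src e = v ∧ N.tgt e = w) ∨ (N.src e = w ∧ N.tgt e = v))
    (fun a b ⟨e, he⟩ => ⟨e, he.symm⟩)
    (fun v C hv hC hC' => exists_crossing_arc (D := {v})
      (by rw [image_singleton]; exact (hN.2 v).isPreconnected)
      (disjoint_singleton_right.2 hv) hC hC')
    (fun C hC ⟨y, hy⟩ => by
      obtain ⟨x, hx, y, hy, -, h⟩ := exists_crossing_arc (N := N) (D := ∅) (C := C)
        (by rw [image_empty, compl_empty]; exact hN.1.isPreconnected) (disjoint_empty _) hC
        ⟨y, hy, notMem_empty y⟩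
      exact ⟨x, hx, y, hy, h⟩)
    (hloop e₀)
  let g : V → ℝ := fun v => f v
  have hlower : ∀ D : Set N.Point,
      (∀ x ∈ D, ∀ y, N.interpolate g y ≤ N.interpolate g x → y ∈ D) → IsPreconnected D :=
    fun D hD => isPreconnected_of_lower (s := N.src e₀)
      (fun v hv => (hlow v hv).imp fun w hw => ⟨hw.1, Nat.cast_lt.2 hw.2⟩) hD
  have hupper : ∀ D : Set N.Point,
      (∀ x ∈ D, ∀ y, N.interpolate g x ≤ N.interpolate g y → y ∈ D) → IsPreconnected D :=
    fun D hD => isPreconnected_of_lower (g := fun v => -g v) (s := N.tgt e₀)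
      (fun v hv => (hup v hv).imp fun w hw => ⟨hw.1, neg_lt_neg (Nat.cast_lt.2 hw.2)⟩)
      (fun x hx y hy => hD x hx y (by
        rw [interpolate_neg, interpolate_neg] at hy; exact neg_le_neg_iff.1 hy))
  have hA : ∀ c, IsPreconnected {x | N.interpolate g x ≤ c} := fun c =>
    hlower _ fun x hx y hy => hy.trans hx
  have hB : ∀ c, IsPreconnected {x | c < N.interpolate g x} := fun c =>
    hupper _ fun x hx y hy => lt_of_lt_of_le hx hy
  have hmeas : Measurable (N.interpolate g) :=
    measurable_of_Iic fun c => measurableSet_of_isPreconnected (hA c)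
  have huniv : N.length univ = 1 := by rw [length_univ, hlen, ENNReal.ofReal_one]
  have : IsProbabilityMeasure N.length := ⟨huniv⟩
  have : IsProbabilityMeasure (N.length.map (N.interpolate g)) :=
    Measure.isProbabilityMeasure_map hmeas.aemeasurable
  -- An injective numbering takes different values at the ends of an arc that is no loop, so the
  -- interpolation is injective on each open arc and its levels have length zero.
  have : NullSingletonClass (N.length.map (N.interpolate g)) := by
    refine ⟨fun c => ?_⟩
    rw [Measure.map_apply hmeas (measurableSet_singleton c),
      length_apply (hmeas (measurableSet_singleton c))]
    refine Finset.sum_eq_zero fun e _ => Set.Subsingleton.measure_zero ?_ _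
    rintro a ⟨ha, ha'⟩ b ⟨hb, hb'⟩
    have hne : g (N.tgt e) - g (N.src e) ≠ 0 := fun h =>
      hloop e (hf (Nat.cast_injective (sub_eq_zero.1 h))).symm
    have hab := (mem_singleton_iff.1 ha).trans (mem_singleton_iff.1 hb).symm
    rw [interpolate_arc g e (Ioo_subset_Icc_self ha'),
      interpolate_arc g e (Ioo_subset_Icc_self hb')] at hab
    exact (div_left_inj' (N.len_pos e).ne').1 (mul_right_cancel₀ hne (add_left_cancel hab))
  obtain ⟨c, hc⟩ := exists_measure_Iic_eq_half (N.length.map (N.interpolate g))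
  rw [Measure.map_apply hmeas measurableSet_Iic] at hc
  have hAc : N.length {x | N.interpolate g x ≤ c} = 1 / 2 := hc
  have hcompl : {x | c < N.interpolate g x} = {x | N.interpolate g x ≤ c}ᶜ := by
    ext x; simp
  have hBc : N.length {x | c < N.interpolate g x} = 1 / 2 := by
    rw [hcompl, prob_compl_eq_one_sub (measurableSet_of_isPreconnected (hA c)), hAc, one_div,
      ENNReal.one_sub_inv_two]
  have hne : ∀ S : Set N.Point, N.length S = 1 / 2 → S.Nonempty := by
    intro S hS
    refine nonempty_of_measure_ne_zero (μ := N.length) ?_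
    simp [hS]
  refine ⟨⟨_, hne _ hAc, hA c⟩, ⟨_, hne _ hBc, hB c⟩, ?_, ?_, hAc, hBc⟩
  · change Disjoint {x | N.interpolate g x ≤ c} {x | c < N.interpolate g x}
    rw [hcompl]
    exact disjoint_compl_right
  · change {x | N.interpolate g x ≤ c} ∪ {x | c < N.interpolate g x} = univ
    rw [hcompl, union_compl_self]

end MetricNetwork

/-! ### The value of the game -/

namespace MetricNetwork

variable {V E : Type*} {N : MetricNetwork V E}

/-- For fixed `S` the reward is a constant times the indicator of the complement of `S`, which is
Borel because `S` is connected. -/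
theorem lintegral_payoff [Finite V] [Fintype E] (μ : Measure N.Point) (S : N.ConnectedSubset) :
    ∫⁻ x, payoff x S ∂μ = N.length S.carrier * μ S.carrierᶜ := by
  have hS := measurableSet_of_isPreconnected S.isConnected.isPreconnected
  rw [← setLIntegral_const, ← lintegral_indicator hS.compl]
  refine lintegral_congr fun x => ?_
  by_cases hx : x ∈ S.carrier <;> simp [payoff, hx]

theorem measurable_measure_carrier (μ : Measure N.Point) [IsFiniteMeasure μ] :
    Measurable fun S : N.ConnectedSubset => μ S.carrier := by
  have h : MeasurableSpace.comap (fun S : N.ConnectedSubset => μ S.carrier) (borel ℝ≥0∞) ≤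
      ⨆ ν : FiniteMeasure N.Point,
        MeasurableSpace.comap (fun S => (ν : Measure N.Point) S.carrier) (borel ℝ≥0∞) :=
    le_iSup (fun ν : FiniteMeasure N.Point => MeasurableSpace.comap
      (fun S : N.ConnectedSubset => (ν : Measure N.Point) S.carrier) (borel ℝ≥0∞)) ⟨μ, ‹_›⟩
  intro T hT
  exact h _ ⟨T, by rwa [← BorelSpace.measurable_eq (α := ℝ≥0∞)], rfl⟩

/-- The integral is λ(S)(1 - μ(S)), built from functions that the sigma-algebra makes measurable by
definition. This allows the integral against the Dirac masses of the even mixture to be evaluated.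
-/
theorem measurable_lintegral_payoff [Finite V] [Fintype E] [IsFiniteMeasure N.length]
    (μ : Measure N.Point) [IsProbabilityMeasure μ] :
    Measurable fun S : N.ConnectedSubset => ∫⁻ x, payoff x S ∂μ := by
  simp_rw [lintegral_payoff, fun S : N.ConnectedSubset =>
    prob_compl_eq_one_sub (μ := μ) (measurableSet_of_isPreconnected S.isConnected.isPreconnected)]
  exact (measurable_measure_carrier _).mul
    (measurable_const.sub (measurable_measure_carrier _))

theorem _root_.ENNReal.mul_one_sub_le_quarter {a : ℝ≥0∞} (ha : a ≤ 1) : a * (1 - a) ≤ 1 / 4 := by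
  lift a to NNReal using ne_top_of_le_ne_top ENNReal.one_ne_top ha
  have ha' : a ≤ 1 := by exact_mod_cast ha
  have h : a * (1 - a) ≤ 1 / 4 := by
    rw [← NNReal.coe_le_coe]
    push_cast [NNReal.coe_sub ha']
    nlinarith [sq_nonneg ((a : ℝ) - 1 / 2)]
  calc (a : ℝ≥0∞) * (1 - a) = ((a * (1 - a) : NNReal) : ℝ≥0∞) := by push_cast; rfl
    _ ≤ ((1 / 4 : NNReal) : ℝ≥0∞) := ENNReal.coe_le_coe.2 h
    _ = 1 / 4 := by simp

/-- Against the uniform strategy no attacker gets more than `1/4`. -/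
theorem expectedPayoff_uniformStrategy_le [Finite V] [Fintype E] (hlen : ∑ e, N.len e = 1)
    (σ : ProbabilityMeasure N.ConnectedSubset) :
    expectedPayoff (N.uniformStrategy hlen) σ ≤ 1 / 4 := by
  have : IsProbabilityMeasure N.length := (N.uniformStrategy hlen).2
  have h : ∀ S : N.ConnectedSubset, ∫⁻ x, payoff x S ∂N.length ≤ 1 / 4 := fun S => by
    rw [lintegral_payoff,
      prob_compl_eq_one_sub (measurableSet_of_isPreconnected S.isConnected.isPreconnected)]
    exact ENNReal.mul_one_sub_le_quarter prob_le_one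
  calc expectedPayoff (N.uniformStrategy hlen) σ
      ≤ ∫⁻ _, 1 / 4 ∂(σ : Measure N.ConnectedSubset) := lintegral_mono h
    _ = 1 / 4 := by simp

/-- The even mixture of the parts of an equal partition gets exactly `1/4` against any defender. -/
theorem expectedPayoff_evenMixture [Finite V] [Fintype E] (hlen : ∑ e, N.len e = 1)
    {A B : N.ConnectedSubset} (h : IsEqualPartition A B) (μ : ProbabilityMeasure N.Point) :
    expectedPayoff μ (evenMixture A B) = 1 / 4 := by
  have : IsProbabilityMeasure N.length := (N.uniformStrategy hlen).2
  obtain ⟨hd, hu, hA, hB⟩ := h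
  -- The complement of each part is the other part, so the probabilities that the trap misses `A`
  -- and misses `B` add up to 1 for every `μ`.
  have hc : A.carrierᶜ = B.carrier := (IsCompl.of_eq hd.eq_bot hu).compl_eq
  have hm := measurable_lintegral_payoff (N := N) (μ : Measure N.Point)
  have hmA := measurableSet_of_isPreconnected A.isConnected.isPreconnected
  calc expectedPayoff μ (evenMixture A B)
      = ∫⁻ S, ∫⁻ x, payoff x S ∂(μ : Measure N.Point)
          ∂((2⁻¹ : ℝ≥0∞) • Measure.dirac A + (2⁻¹ : ℝ≥0∞) • Measure.dirac B) := rfl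
    _ = 2⁻¹ * (1 / 2 * (μ : Measure N.Point) A.carrierᶜ) +
          2⁻¹ * (1 / 2 * (μ : Measure N.Point) B.carrierᶜ) := by
        rw [lintegral_add_measure, lintegral_smul_measure, lintegral_smul_measure,
          lintegral_dirac' _ hm, lintegral_dirac' _ hm, lintegral_payoff, lintegral_payoff,
          hA, hB, smul_eq_mul, smul_eq_mul]
    _ = 2⁻¹ * (1 / 2) * ((μ : Measure N.Point) A.carrier +
          (μ : Measure N.Point) A.carrierᶜ) := by
        rw [← hc, compl_compl]; ring
    _ = 1 / 4 := by
        rw [measure_add_measure_compl hmA, measure_univ, mul_one, one_div, one_div,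
          ← ENNReal.mul_inv (by simp) (by simp)]
        norm_num

end MetricNetwork

theorem theorem6 {V E : Type*} [Finite V] [Fintype E] (N : MetricNetwork V E)
    (hN : N.IsTwoConnected) (hlen : ∑ e, N.len e = 1) :
    (∃ A B : N.ConnectedSubset, MetricNetwork.IsEqualPartition A B) ∧
    N.HasGameValue (1 / 4) ∧
    MetricNetwork.IsOptimalDefender (N.uniformStrategy hlen) ∧
    ∀ A B : N.ConnectedSubset, MetricNetwork.IsEqualPartition A B →
      MetricNetwork.IsOptimalAttacker (MetricNetwork.evenMixture A B) := by
  obtain ⟨A, B, hAB⟩ := MetricNetwork.exists_isEqualPartition hN hlen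
  -- The two payoff bounds, each read from both players' sides, give four inequalities with the
  -- common constant 1/4; value and optimality follow without a minimax theorem.
  have hdef : MetricNetwork.defenderGuarantee (N.uniformStrategy hlen) ≤ 1 / 4 :=
    iSup_le (MetricNetwork.expectedPayoff_uniformStrategy_le hlen)
  have hdef' : ∀ μ : ProbabilityMeasure N.Point,
      1 / 4 ≤ MetricNetwork.defenderGuarantee μ := fun μ =>
    (MetricNetwork.expectedPayoff_evenMixture hlen hAB μ).symm.le.trans
      (le_iSup (MetricNetwork.expectedPayoff μ) _)
  have hatt : ∀ A B : N.ConnectedSubset, MetricNetwork.IsEqualPartition A B →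
      1 / 4 ≤ MetricNetwork.attackerGuarantee (MetricNetwork.evenMixture A B) := fun A B h =>
    le_iInf fun μ => (MetricNetwork.expectedPayoff_evenMixture hlen h μ).symm.le
  have hatt' : ∀ σ : ProbabilityMeasure N.ConnectedSubset,
      MetricNetwork.attackerGuarantee σ ≤ 1 / 4 := fun σ =>
    (iInf_le _ (N.uniformStrategy hlen)).trans
      (MetricNetwork.expectedPayoff_uniformStrategy_le hlen σ)
  exact ⟨⟨A, B, hAB⟩,
    ⟨le_antisymm ((iInf_le _ _).trans hdef) (le_iInf hdef'),
      le_antisymm (iSup_le hatt') ((hatt A B hAB).trans (le_iSup _ _))⟩,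
    fun μ' => hdef.trans (hdef' μ'), fun A B h σ' => (hatt' σ').trans (hatt A B h)⟩
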